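/- For $d\in\mathbb N=\{1,2,\dots\}$ let $\varphi_d(x)=(2\pi)^{-d/2}\exp(-\frac12\sum_{j=1}^d|x_j|^2)$, let $f_d\colon\mathbb R^d\to\mathbb R$ be given by $f_d(x)=\sum_{j=1}^d[\max\{|x_j|-\sqrt{2d},0\}]^2$, and let $\mathfrak f_d(x)=\big[\int_{\mathbb R^d}|f_d(y)|^2\varphi_d(y)\,dy\big]^{-1/2}f_d(x)$. A (ReLU) network is a tuple $\Phi=((W_1,B_1),\dots,(W_L,B_L))$ with $L\in\mathbb N$, $W_k\in\mathbb R^{l_k\times l_{k-1}}$, $B_k\in\mathbb R^{l_k}$ and $l_0,\dots,l_L\in\mathbb N$. Its input dimension is $\mathcal I(\Phi)=l_0$, its output dimension is $\mathcal O(\Phi)=l_L$, its number of hidden layers is $\mathcal H(\Phi)=L-1$, its number of parameters is $\mathcal P(\Phi)=\sum_{k=1}^L l_k(l_{k-1}+1)$, and $\|\mathcal T(\Phi)\|_\infty$ is the maximum of the absolute values of all entries of $W_1,B_1,\dots,W_L,B_L$. Its realization $\mathcal R(\Phi)\colon\mathbb R^{l_0}\to\mathbb R^{l_L}$ is $v_0\mapsto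 W_Lv_{L-1}+B_L$, where $v_k=\mathfrak R(W_kv_{k-1}+B_k)$ for $1\le k<L$ and $\mathfrak R$ takes the maximum with $0$ in every coordinate. For $\Phi$ with $\mathcal I(\Phi)=d$ and $\mathcal O(\Phi)=1$ write $\mathrm{err}_d(\Phi)=\big[\int_{\mathbb R^d}|(\mathcal R(\Phi))(x)-\mathfrak f_d(x)|^2\varphi_d(x)\,dx\big]^{1/2}$. **Theorem.** Let $\delta\in(0,1]$ and $\varepsilon\in(0,\frac12]$. Then there exists $\mathfrak C\in(0,\infty)$ such that (i) for all $\mathfrak c\in[\mathfrak C,\infty)$ and $d\in\mathbb N$, $$\min\Big\{p\in\mathbb N\colon\ \exists\,\Phi\colon\ p=\mathcal P(\Phi),\ \mathcal I(\Phi)=d,\ \mathcal O(\Phi)=1,\ d\le\mathcal H(\Phi)\le\mathfrak c d,\ \|\mathcal T(\Phi)\|_\infty\le\mathfrak c d^{\mathfrak c},\ \mathrm{err}_d(\Phi)\le\varepsilon\Big\}\le\mathfrak c d^3;$$ (ii) for all $\mathfrak c\in[\mathfrak C,\infty)$ and $d\in\mathbb N$, $$\min\Big\{p\in\mathbb N\colon\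 \exists\,\Phi\colon\ p=\mathcal P(\Phi),\ \mathcal I(\Phi)=d,\ \mathcal O(\Phi)=1,\ \mathcal H(\Phi)\le\mathfrak c d^{1-\delta},\ \|\mathcal T(\Phi)\|_\infty\le\mathfrak c d^{\mathfrak c},\ \mathrm{err}_d(\Phi)\le\varepsilon\Big\}\ge(1+\mathfrak c^{-3})^{(d^\delta)}.$$ In both parts the minimum exists, i.e. the set is non-empty. -/

import Mathlib

open MeasureTheory

/-- The multidimensional rectifier `(x₁, …, x_d) ↦ (max {x₁, 0}, …, max {x_d, 0})`. -/
noncomputable def relu {d : ℕ} (x : Fin d → ℝ) : Fin d → ℝ := fun i => max (x i) 0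

/-- Fully connected feedforward networks with input dimension `m` and output dimension `n`, i.e.
tuples `((W₁, B₁), …, (W_L, B_L))`, `L ≥ 1`, with `W_k ∈ ℝ^{l_k × l_{k-1}}`, `B_k ∈ ℝ^{l_k}`,
`l₀ = m`, `l_L = n` and hidden widths `l₁, …, l_{L-1} ≥ 1`. The tuple is read from the input side:
`output W B` is the one-element tuple `((W, B))` and `hidden _ W B Ψ` is `Ψ` with the pair `(W, B)`
put in front. -/
inductive ANN : ℕ → ℕ → Type
  | output {m n : ℕ} (W : Matrix (Fin n) (Fin m) ℝ) (B : Fin n → ℝ) : ANN m n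
  | hidden {m k n : ℕ} (hk : 0 < k) (W : Matrix (Fin k) (Fin m) ℝ) (B : Fin k → ℝ)
      (Ψ : ANN k n) : ANN m n

namespace ANN

/-- The realization `v₀ ↦ W_L v_{L-1} + B_L`, where `v_k = relu (W_k v_{k-1} + B_k)`. -/
noncomputable def realize : {m n : ℕ} → ANN m n → (Fin m → ℝ) → (Fin n → ℝ)
  | _, _, output W B => fun x => W.mulVec x + B
  | _, _, hidden _ W B Ψ => fun x => Ψ.realize (relu (W.mulVec x + B))

/-- The number of parameters `∑_{k=1}^L l_k (l_{k-1} + 1)`. -/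
def numParams : {m n : ℕ} → ANN m n → ℕ
  | m, n, output _ _ => n * (m + 1)
  | m, _, hidden (k := k) _ _ _ Ψ => k * (m + 1) + Ψ.numParams

/-- The number of hidden layers `L - 1`. -/
def numHidden : {m n : ℕ} → ANN m n → ℕ
  | _, _, output _ _ => 0
  | _, _, hidden _ _ _ Ψ => Ψ.numHidden + 1

/-- The entries of `(W, B)` listed in one vector: `W` row by row, followed by `B`. -/
def layerVec {m n : ℕ} (W : Matrix (Fin n) (Fin m) ℝ) (B : Fin n → ℝ) :
    Fin (n * (m + 1)) → ℝ :=
  Fin.append (fun i : Fin (n * m) => W (finProdFinEquiv.symm i).1 (finProdFinEquiv.symm i).2) B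

/-- The vector of all parameters of a network, in the order `W₁, B₁, W₂, B₂, …, W_L, B_L`.
Its norm as an element of `Fin Φ.numParams → ℝ` is the maximum norm. -/
def paramVec : {m n : ℕ} → (Φ : ANN m n) → Fin Φ.numParams → ℝ
  | _, _, output W B => layerVec W B
  | _, _, hidden _ W B Ψ => Fin.append (layerVec W B) Ψ.paramVec

end ANN

/-- The density of the standard normal distribution on `ℝ^d`. -/
noncomputable def gaussDensity (d : ℕ) (x : Fin d → ℝ) : ℝ :=
  (2 * Real.pi) ^ (-(d : ℝ) / 2) * Real.exp (-(1 / 2) * ∑ j, |x j| ^ 2)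

/-- The function `f_d(x) = ∑_j [max {|x_j| - √(2d), 0}]²`. -/
noncomputable def rawTarget (d : ℕ) (x : Fin d → ℝ) : ℝ :=
  ∑ j, (max (|x j| - Real.sqrt (2 * d)) 0) ^ 2

/-- The function `f_d` normalised in `L²` of the standard normal distribution. -/
noncomputable def target (d : ℕ) (x : Fin d → ℝ) : ℝ :=
  (∫ y : Fin d → ℝ, |rawTarget d y| ^ 2 * gaussDensity d y) ^ (-(1 / 2) : ℝ) * rawTarget d x

/-- The distance between a network with scalar output and the target function in `L²` of the
standard normal distribution. -/
noncomputable def l2Error {d : ℕ} (Φ : ANN d 1) : ℝ :=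
  (∫ x : Fin d → ℝ, |Φ.realize x 0 - target d x| ^ 2 * gaussDensity d x) ^ (1 / 2 : ℝ)

/-- The density of the standard normal distribution on `ℝ`. -/
noncomputable def stdGauss (t : ℝ) : ℝ := (√(2 * Real.pi))⁻¹ * Real.exp (-t ^ 2 / 2)

lemma stdGauss_pos (t : ℝ) : 0 < stdGauss t := by
  unfold stdGauss; positivity

lemma stdGauss_nonneg (t : ℝ) : 0 ≤ stdGauss t := (stdGauss_pos t).le

lemma continuous_stdGauss : Continuous stdGauss := by
  unfold stdGauss; fun_prop

lemma stdGauss_eq_gaussianPDFReal : stdGauss = ProbabilityTheory.gaussianPDFReal 0 1 := by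
  ext t
  simp [stdGauss, ProbabilityTheory.gaussianPDFReal]

lemma integrable_stdGauss : Integrable stdGauss := by
  rw [stdGauss_eq_gaussianPDFReal]
  exact ProbabilityTheory.integrable_gaussianPDFReal 0 1

lemma integral_stdGauss : ∫ t, stdGauss t = 1 := by
  rw [stdGauss_eq_gaussianPDFReal]
  exact ProbabilityTheory.integral_gaussianPDFReal_eq_one 0 one_ne_zero

lemma stdGauss_add (a y : ℝ) :
    stdGauss (a + y) = stdGauss a * Real.exp (-(a * y) - y ^ 2 / 2) := by
  unfold stdGauss
  rw [mul_assoc, ← Real.exp_add]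
  ring_nf

lemma gaussDensity_eq_prod {d : ℕ} (x : Fin d → ℝ) :
    gaussDensity d x = ∏ j, stdGauss (x j) := by
  unfold gaussDensity stdGauss
  rw [Finset.prod_mul_distrib, ← Real.exp_sum, Finset.prod_const, Finset.card_univ,
    Fintype.card_fin]
  congr 1
  · rw [Real.sqrt_eq_rpow, ← Real.rpow_neg (by positivity), ← Real.rpow_natCast,
      ← Real.rpow_mul (by positivity)]
    congr 1
    ring
  · congr 1
    rw [Finset.mul_sum]
    refine Finset.sum_congr rfl fun j _ => ?_
    rw [sq_abs]
    ring

lemma gaussDensity_pos {d : ℕ} (x : Fin d → ℝ) : 0 < gaussDensity d x := by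
  rw [gaussDensity_eq_prod]
  exact Finset.prod_pos fun j _ => stdGauss_pos _

lemma continuous_gaussDensity (d : ℕ) : Continuous (gaussDensity d) := by
  unfold gaussDensity; fun_prop

lemma coord_mul_gaussDensity {d : ℕ} (F : ℝ → ℝ) (j : Fin d) (x : Fin d → ℝ) :
    F (x j) * gaussDensity d x =
      ∏ i, (fun i t => if i = j then F t * stdGauss t else stdGauss t : Fin d → ℝ → ℝ) i (x i) := by
  rw [gaussDensity_eq_prod]
  have h : ∀ i, (if i = j then F (x i) * stdGauss (x i) else stdGauss (x i)) =
      (if i = j then F (x i) else 1) * stdGauss (x i) := by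
    intro i; split_ifs <;> simp
  simp only [h]
  rw [Finset.prod_mul_distrib]
  simp

lemma integral_coord {d : ℕ} (F : ℝ → ℝ) (j : Fin d) :
    ∫ x : Fin d → ℝ, F (x j) * gaussDensity d x = ∫ t, F t * stdGauss t := by
  simp only [coord_mul_gaussDensity]
  rw [integral_fintype_prod_volume_eq_prod
    (fun i t => if i = j then F t * stdGauss t else stdGauss t : Fin d → ℝ → ℝ)]
  rw [Finset.prod_eq_single j]
  · simp
  · intro i _ hij
    simp [hij, integral_stdGauss]
  · simp

lemma integrable_coord {d : ℕ} {F : ℝ → ℝ} (hF : Integrable fun t => F t * stdGauss t)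
    (j : Fin d) : Integrable fun x : Fin d → ℝ => F (x j) * gaussDensity d x := by
  simp only [coord_mul_gaussDensity]
  refine Integrable.fintype_prod
    (f := (fun i t => if i = j then F t * stdGauss t else stdGauss t : Fin d → ℝ → ℝ)) ?_
  intro i
  by_cases h : i = j
  · simpa [h] using hF
  · simpa [h] using integrable_stdGauss

lemma integrable_exp_mul_stdGauss : Integrable fun t => Real.exp (t ^ 2 / 4) * stdGauss t := by
  have h := (integrable_exp_neg_mul_sq (b := 1 / 4) (by norm_num)).const_mul (√(2 * Real.pi))⁻¹
  refine h.congr (Filter.Eventually.of_forall fun t => ?_)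
  unfold stdGauss
  simp only
  rw [mul_left_comm, ← Real.exp_add]
  ring_nf

/-- A function of growth at most `exp (t² / 4)` is integrable for the standard normal
distribution. -/
lemma integrable_mul_stdGauss {F : ℝ → ℝ} (hF : Measurable F) {A : ℝ}
    (h : ∀ t, |F t| ≤ A * Real.exp (t ^ 2 / 4)) : Integrable fun t => F t * stdGauss t := by
  refine (integrable_exp_mul_stdGauss.const_mul A).mono'
    (hF.mul continuous_stdGauss.measurable).aestronglyMeasurable
    (Filter.Eventually.of_forall fun t => ?_)
  rw [Real.norm_eq_abs, abs_mul, abs_of_pos (stdGauss_pos t), ← mul_assoc]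
  exact mul_le_mul_of_nonneg_right (h t) (stdGauss_nonneg t)

lemma integrable_mul_gaussDensity {d : ℕ} {F : (Fin d → ℝ) → ℝ} (hF : Measurable F) {A : ℝ}
    (h : ∀ x, |F x| ≤ A * ∑ j, Real.exp (x j ^ 2 / 4)) :
    Integrable fun x => F x * gaussDensity d x := by
  have h1 : Integrable fun x : Fin d → ℝ =>
      ∑ j, Real.exp (x j ^ 2 / 4) * gaussDensity d x :=
    integrable_finsetSum _ fun j _ =>
      integrable_coord (F := fun t => Real.exp (t ^ 2 / 4)) integrable_exp_mul_stdGauss j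
  refine (h1.const_mul A).mono'
    (hF.mul (continuous_gaussDensity d).measurable).aestronglyMeasurable
    (Filter.Eventually.of_forall fun x => ?_)
  rw [Real.norm_eq_abs, abs_mul, abs_of_pos (gaussDensity_pos x), ← Finset.sum_mul, ← mul_assoc]
  exact mul_le_mul_of_nonneg_right (h x) (gaussDensity_pos x).le

lemma sq_pow_le_exp (t : ℝ) (k : ℕ) :
    (t ^ 2) ^ k ≤ 4 ^ k * k.factorial * Real.exp (t ^ 2 / 4) := by
  have h := Real.pow_div_factorial_le_exp (t ^ 2 / 4) (by positivity) k
  rw [div_le_iff₀ (by positivity), div_pow, div_le_iff₀ (by positivity)] at h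
  linarith

/-- The integral of a function of the excess of `|x|` over `a`. -/
lemma integral_excess {a : ℝ} (ha : 0 ≤ a) (G : ℝ → ℝ) (hG : G 0 = 0) :
    ∫ t, G (max (|t| - a) 0) * stdGauss t =
      2 * stdGauss a * ∫ y in Set.Ioi 0, G y * Real.exp (-(a * y) - y ^ 2 / 2) := by
  have h1 : ∀ t, G (max (|t| - a) 0) * stdGauss t =
      (fun u => G (max (u - a) 0) * stdGauss u) |t| := by
    intro t; simp [stdGauss]
  simp only [h1]
  rw [integral_comp_abs (f := fun u => G (max (u - a) 0) * stdGauss u), mul_assoc]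
  congr 1
  rw [setIntegral_eq_of_subset_of_forall_sdiff_eq_zero measurableSet_Ioi
    (Set.Ioi_subset_Ioi ha)]
  · rw [← (measurePreserving_add_left volume a).setIntegral_preimage_emb
      (measurableEmbedding_addLeft a), ← integral_const_mul]
    have : (fun x => a + x) ⁻¹' Set.Ioi a = Set.Ioi 0 := by ext; simp
    rw [this]
    refine setIntegral_congr_fun measurableSet_Ioi fun y hy => ?_
    simp only [Set.mem_Ioi] at hy
    simp only [add_sub_cancel_left, max_eq_left hy.le, stdGauss_add]
    ring
  · intro x hx
    have : x ≤ a := by simpa using hx.2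
    simp [max_eq_right (sub_nonpos.2 this), hG]

lemma integrableOn_pow_mul_exp {a : ℝ} (ha : 0 < a) (k : ℕ) :
    IntegrableOn (fun y => y ^ k * Real.exp (-(a * y))) (Set.Ioi 0) := by
  have := integrableOn_rpow_mul_exp_neg_mul_rpow (p := 1) (s := k) (b := a)
    (by linarith [(Nat.cast_nonneg k : (0 : ℝ) ≤ k)]) one_pos ha
  simpa using this

lemma integral_pow_mul_exp {a : ℝ} (ha : 0 < a) (k : ℕ) :
    ∫ y in Set.Ioi 0, y ^ k * Real.exp (-(a * y)) = k.factorial / a ^ (k + 1) := by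
  have := Real.integral_rpow_mul_exp_neg_mul_Ioi (a := k + 1) (r := a) (by positivity) ha
  simp only [add_sub_cancel_right, Real.rpow_natCast] at this
  rw [this, Real.Gamma_nat_eq_factorial]
  norm_cast
  rw [div_pow, one_pow]
  ring

lemma le_integral_pow_four {a : ℝ} (ha : 2 ≤ a ^ 2) (ha0 : 0 < a) :
    1 / (20 * a ^ 5) ≤ ∫ y in Set.Ioi 0, y ^ 4 * Real.exp (-(a * y) - y ^ 2 / 2) := by
  have hint : IntegrableOn (fun y => y ^ 4 * Real.exp (-(a * y) - y ^ 2 / 2)) (Set.Ioi 0) := by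
    refine (integrableOn_pow_mul_exp ha0 4).mono' (by fun_prop)
      (Filter.Eventually.of_forall fun y => ?_)
    rw [Real.norm_eq_abs, abs_of_nonneg (by positivity)]
    gcongr
    nlinarith [sq_nonneg y]
  have h1 : ∫ y in Set.Ioc 0 a⁻¹, y ^ 4 * Real.exp (-(a * y) - y ^ 2 / 2) ≤
      ∫ y in Set.Ioi 0, y ^ 4 * Real.exp (-(a * y) - y ^ 2 / 2) :=
    setIntegral_mono_set hint (Filter.Eventually.of_forall fun y => by positivity)
      (Filter.Eventually.of_forall Set.Ioc_subset_Ioi_self)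
  refine le_trans ?_ h1
  have h2 : ∫ y in Set.Ioc 0 a⁻¹, y ^ 4 * (1 / 4 : ℝ) ≤
      ∫ y in Set.Ioc 0 a⁻¹, y ^ 4 * Real.exp (-(a * y) - y ^ 2 / 2) := by
    refine setIntegral_mono_on ?_ (hint.mono_set Set.Ioc_subset_Ioi_self) measurableSet_Ioc ?_
    · exact (Continuous.integrableOn_Icc (by fun_prop)).mono_set Set.Ioc_subset_Icc_self
    · intro y hy
      have hy1 : a * y ≤ 1 := by
        calc a * y ≤ a * a⁻¹ := by gcongr; exact hy.2
          _ = 1 := mul_inv_cancel₀ ha0.ne'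
      have hy2 : y ^ 2 ≤ 1 / 2 := by
        have : 0 ≤ a * y := mul_nonneg ha0.le hy.1.le
        nlinarith [sq_nonneg y, sq_nonneg (a * y)]
      gcongr
      have he : Real.exp (5 / 4) ≤ 4 := by
        have h4 : Real.exp (5 / 4) ^ 4 = Real.exp 1 ^ 5 := by
          rw [← Real.exp_nat_mul, ← Real.exp_nat_mul]; norm_num
        have h5 : Real.exp 1 ^ 5 ≤ 3 ^ 5 := by
          gcongr
          exact Real.exp_one_lt_three.le
        by_contra hc
        push Not at hc
        have : (4 : ℝ) ^ 4 < Real.exp (5 / 4) ^ 4 := by gcongr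
        rw [h4] at this
        linarith
      calc (1 / 4 : ℝ) ≤ 1 / Real.exp (5 / 4) := by gcongr
        _ = Real.exp (-(5 / 4)) := by rw [Real.exp_neg, one_div]
        _ ≤ _ := by
          apply Real.exp_le_exp.2
          linarith
  refine le_trans (le_of_eq ?_) h2
  rw [← intervalIntegral.integral_of_le (by positivity), intervalIntegral.integral_mul_const,
    integral_pow]
  norm_num
  ring

lemma integral_pow_excess_le {a : ℝ} (ha : 0 < a) {G : ℝ → ℝ} (hG : Continuous G) {A B : ℝ}
    {k l : ℕ} (h0 : ∀ y, 0 ≤ G y)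
    (h : ∀ y, 0 ≤ y → G y ≤ A * y ^ k + B * y ^ l) :
    ∫ y in Set.Ioi 0, G y * Real.exp (-(a * y) - y ^ 2 / 2) ≤
      A * (k.factorial / a ^ (k + 1)) + B * (l.factorial / a ^ (l + 1)) := by
  rw [← integral_pow_mul_exp ha, ← integral_pow_mul_exp ha, ← integral_const_mul,
    ← integral_const_mul, ← integral_add ((integrableOn_pow_mul_exp ha k).const_mul A)
      ((integrableOn_pow_mul_exp ha l).const_mul B)]
  have hb : ∀ y ∈ Set.Ioi (0 : ℝ), G y * Real.exp (-(a * y) - y ^ 2 / 2) ≤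
      A * (y ^ k * Real.exp (-(a * y))) + B * (y ^ l * Real.exp (-(a * y))) := by
    intro y hy
    calc G y * Real.exp (-(a * y) - y ^ 2 / 2) ≤ G y * Real.exp (-(a * y)) := by
          have := h0 y
          gcongr
          nlinarith [sq_nonneg y]
      _ ≤ (A * y ^ k + B * y ^ l) * Real.exp (-(a * y)) := by
          gcongr
          exact h y (le_of_lt hy)
      _ = _ := by ring
  have hi := ((integrableOn_pow_mul_exp ha k).const_mul A).add
      ((integrableOn_pow_mul_exp ha l).const_mul B)
  refine setIntegral_mono_on ?_ hi measurableSet_Ioi hb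
  refine hi.mono' (by fun_prop) ?_
  refine (ae_restrict_iff' measurableSet_Ioi).2 (Filter.Eventually.of_forall fun y hy => ?_)
  rw [Real.norm_eq_abs, abs_of_nonneg (mul_nonneg (h0 y) (Real.exp_pos _).le)]
  exact hb y hy

/-- The left Riemann sum with step `s` and `N` nodes of `y² = ∫₀^∞ 2 max (y - t) 0 dt`. -/
noncomputable def plSquare (N : ℕ) (s y : ℝ) : ℝ :=
  ∑ k ∈ Finset.range N, 2 * s * max (y - k * s) 0

lemma continuous_plSquare (N : ℕ) (s : ℝ) : Continuous (plSquare N s) := by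
  unfold plSquare; fun_prop

lemma plSquare_zero (N : ℕ) {s : ℝ} (hs : 0 ≤ s) : plSquare N s 0 = 0 := by
  unfold plSquare
  refine Finset.sum_eq_zero fun k _ => ?_
  rw [max_eq_right (by simp only [zero_sub, Left.neg_nonpos_iff]; positivity), mul_zero]

lemma sq_sub_sq_le_plSquare (N : ℕ) {s y : ℝ} (hs : 0 < s) (hy : 0 ≤ y) :
    y ^ 2 - (max (y - N * s) 0) ^ 2 ≤ plSquare N s y := by
  unfold plSquare
  induction N with
  | zero => simp [max_eq_left hy]
  | succ N ih =>
    rw [Finset.sum_range_succ]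
    have key : (max (y - N * s) 0) ^ 2 - (max (y - (N + 1 : ℕ) * s) 0) ^ 2 ≤
        2 * s * max (y - N * s) 0 := by
      push_cast
      rcases le_total (y - N * s) 0 with h | h
      · rw [max_eq_right h, max_eq_right (by nlinarith)]; simp
      · rw [max_eq_left h]
        rcases le_total (y - (N + 1) * s) 0 with h' | h'
        · rw [max_eq_right h']; nlinarith
        · rw [max_eq_left h']; nlinarith
    linarith

lemma plSquare_le (N : ℕ) {s y : ℝ} (hs : 0 < s) (hy : 0 ≤ y) :
    plSquare N s y ≤ y ^ 2 - (max (y - N * s) 0) ^ 2 + 2 * s * (y - max (y - N * s) 0) := by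
  unfold plSquare
  induction N with
  | zero => simp [max_eq_left hy]
  | succ N ih =>
    rw [Finset.sum_range_succ]
    have key : 2 * s * max (y - (N + 1 : ℕ) * s) 0 ≤
        (max (y - N * s) 0) ^ 2 - (max (y - (N + 1 : ℕ) * s) 0) ^ 2 := by
      push_cast
      rcases le_total (y - N * s) 0 with h | h
      · rw [max_eq_right h, max_eq_right (by nlinarith)]; simp
      · rw [max_eq_left h]
        rcases le_total (y - (N + 1) * s) 0 with h' | h'
        · rw [max_eq_right h']; nlinarith
        · rw [max_eq_left h']; nlinarith
    linarith

lemma abs_plSquare_sub_sq_le {N : ℕ} (hN : 0 < N) {s y : ℝ} (hs : 0 < s) (hy : 0 ≤ y) :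
    |plSquare N s y - y ^ 2| ≤ 2 * s * y + y ^ 3 / (N * s) := by
  have h1 := sq_sub_sq_le_plSquare N hs hy
  have h2 := plSquare_le N hs hy
  have hNs : 0 < N * s := by positivity
  have h3 : (max (y - N * s) 0) ^ 2 ≤ y ^ 3 / (N * s) := by
    rw [le_div_iff₀ hNs]
    rcases le_total (y - N * s) 0 with h | h
    · rw [max_eq_right h]; simp; positivity
    · rw [max_eq_left h]
      have : (y - N * s) ^ 2 ≤ y ^ 2 := by
        apply pow_le_pow_left₀ h; linarith
      calc (y - N * s) ^ 2 * (N * s) ≤ y ^ 2 * y := by gcongr; linarith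
        _ = y ^ 3 := by ring
  have h4 : 0 ≤ s * max (y - N * s) 0 := by positivity
  have h5 : 0 ≤ s * y := by positivity
  have h6 := sq_nonneg (max (y - N * s) 0)
  rw [abs_le]
  constructor <;> nlinarith

lemma plSquare_sub_sq_sq_le {N : ℕ} (hN : 0 < N) {s y : ℝ} (hs : 0 < s) (hy : 0 ≤ y) :
    (plSquare N s y - y ^ 2) ^ 2 ≤ 8 * s ^ 2 * y ^ 2 + 2 / (N * s) ^ 2 * y ^ 6 := by
  have h := abs_plSquare_sub_sq_le hN hs hy
  calc (plSquare N s y - y ^ 2) ^ 2 = |plSquare N s y - y ^ 2| ^ 2 := (sq_abs _).symm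
    _ ≤ (2 * s * y + y ^ 3 / (N * s)) ^ 2 := by gcongr
    _ ≤ 2 * ((2 * s * y) ^ 2 + (y ^ 3 / (N * s)) ^ 2) := by
        nlinarith [sq_nonneg (2 * s * y - y ^ 3 / (N * s))]
    _ = _ := by rw [div_pow]; ring

lemma excess_le_abs {a : ℝ} (ha : 0 ≤ a) (t : ℝ) : max (|t| - a) 0 ≤ |t| :=
  max_le (by linarith) (abs_nonneg t)

lemma excess_pow_le {a : ℝ} (ha : 0 ≤ a) (t : ℝ) (k : ℕ) :
    (max (|t| - a) 0) ^ (2 * k) ≤ 4 ^ k * k.factorial * Real.exp (t ^ 2 / 4) := by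
  refine le_trans ?_ (sq_pow_le_exp t k)
  rw [← pow_mul, ← Even.pow_abs (even_two_mul k) t]
  exact pow_le_pow_left₀ (le_max_right _ _) (excess_le_abs ha t) _

section Target

variable {d : ℕ}

lemma measurable_rawTarget (d : ℕ) : Measurable (rawTarget d) := by
  unfold rawTarget
  apply Continuous.measurable
  fun_prop

lemma rawTarget_sq_le (x : Fin d → ℝ) :
    rawTarget d x ^ 2 ≤ (32 * d : ℝ) * ∑ j, Real.exp (x j ^ 2 / 4) := by
  unfold rawTarget
  refine (sq_sum_le_card_mul_sum_sq (s := Finset.univ)).trans ?_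
  rw [Finset.card_univ, Fintype.card_fin, mul_comm (32 : ℝ), mul_assoc, Finset.mul_sum (a := (32 : ℝ))]
  gcongr with j
  have := excess_pow_le (Real.sqrt_nonneg (2 * d)) (x j) 2
  rw [← pow_mul]
  norm_num [Nat.factorial] at this ⊢
  exact this

lemma integrable_rawTarget_sq (d : ℕ) :
    Integrable fun x => rawTarget d x ^ 2 * gaussDensity d x := by
  refine integrable_mul_gaussDensity ((measurable_rawTarget d).pow_const 2) (A := 32 * d) ?_
  intro x
  rw [abs_of_nonneg (sq_nonneg _)]
  exact rawTarget_sq_le x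

/-- The squared norm of `rawTarget d` in `L²` of the standard normal distribution. -/
noncomputable def rawNormSq (d : ℕ) : ℝ := ∫ x : Fin d → ℝ, rawTarget d x ^ 2 * gaussDensity d x

lemma target_eq (x : Fin d → ℝ) :
    target d x = (rawNormSq d) ^ (-(1 / 2) : ℝ) * rawTarget d x := by
  simp only [target, rawNormSq, sq_abs]

lemma integrable_excess_pow_four {a : ℝ} (ha : 0 ≤ a) :
    Integrable fun t => (max (|t| - a) 0) ^ 4 * stdGauss t := by
  refine integrable_mul_stdGauss (A := 32) (Continuous.measurable (by fun_prop)) fun t => ?_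
  rw [abs_of_nonneg (by positivity)]
  have := excess_pow_le ha t 2
  norm_num [Nat.factorial] at this ⊢
  exact this

lemma le_rawNormSq (hd : 1 ≤ d) :
    d * (2 * stdGauss √(2 * d) * (1 / (20 * √(2 * d) ^ 5))) ≤ rawNormSq d := by
  have hd' : (1 : ℝ) ≤ d := by exact_mod_cast hd
  have ha0 : 0 < √(2 * d : ℝ) := by positivity
  have ha2 : 2 ≤ √(2 * d : ℝ) ^ 2 := by rw [Real.sq_sqrt (by positivity)]; linarith
  have h1 : 2 * stdGauss √(2 * d) * (1 / (20 * √(2 * d) ^ 5)) ≤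
      ∫ t, (max (|t| - √(2 * d)) 0) ^ 4 * stdGauss t := by
    rw [integral_excess ha0.le (fun y => y ^ 4) (by simp)]
    have := stdGauss_nonneg √(2 * d)
    gcongr
    exact le_integral_pow_four ha2 ha0
  have hi := fun j : Fin d => integrable_coord (integrable_excess_pow_four ha0.le) j
  calc d * (2 * stdGauss √(2 * d) * (1 / (20 * √(2 * d) ^ 5)))
      ≤ ∑ j : Fin d, ∫ x : Fin d → ℝ, (max (|x j| - √(2 * d)) 0) ^ 4 * gaussDensity d x := by
        simp only [integral_coord (fun t => (max (|t| - √(2 * d)) 0) ^ 4)]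
        rw [Finset.sum_const, Finset.card_univ, Fintype.card_fin, nsmul_eq_mul]
        gcongr
    _ = ∫ x : Fin d → ℝ, ∑ j, (max (|x j| - √(2 * d)) 0) ^ 4 * gaussDensity d x :=
        (integral_finsetSum _ fun j _ => hi j).symm
    _ ≤ rawNormSq d := by
        refine integral_mono (integrable_finsetSum _ fun j _ => hi j)
          (integrable_rawTarget_sq d) fun x => ?_
        simp only
        rw [← Finset.sum_mul]
        refine mul_le_mul_of_nonneg_right ?_ (gaussDensity_pos x).le
        unfold rawTarget
        have := Finset.sum_sq_le_sq_sum_of_nonneg (s := Finset.univ)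
          (f := fun j => (max (|x j| - √(2 * d)) 0) ^ 2) (fun j _ => sq_nonneg _)
        simpa [← pow_mul] using this

lemma rawNormSq_pos (hd : 1 ≤ d) : 0 < rawNormSq d := by
  refine lt_of_lt_of_le ?_ (le_rawNormSq hd)
  have := stdGauss_pos √(2 * d)
  positivity

lemma rawNormSq_rpow_sq (hd : 1 ≤ d) :
    ((rawNormSq d) ^ (-(1 / 2) : ℝ)) ^ 2 = (rawNormSq d)⁻¹ := by
  rw [← Real.rpow_natCast, ← Real.rpow_mul (rawNormSq_pos hd).le, ← Real.rpow_neg_one]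
  norm_num

lemma rawNormSq_rpow_le (hd : 1 ≤ d) :
    (rawNormSq d) ^ (-(1 / 2) : ℝ) ≤ (31 * d) ^ (d + 1) := by
  have hd' : (1 : ℝ) ≤ d := by exact_mod_cast hd
  rw [← sq_le_sq₀ (Real.rpow_nonneg (rawNormSq_pos hd).le _) (by positivity),
    rawNormSq_rpow_sq hd]
  have hφ := stdGauss_pos √(2 * d)
  have hpi : √(2 * Real.pi) ≤ 3 := by
    rw [Real.sqrt_le_left (by norm_num)]
    linarith [Real.pi_lt_four]
  have hφ' : (stdGauss √(2 * d))⁻¹ ≤ 3 * 3 ^ d := by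
    unfold stdGauss
    rw [mul_inv, inv_inv, ← Real.exp_neg, Real.sq_sqrt (by positivity)]
    have : Real.exp (-(-(2 * d : ℝ) / 2)) = Real.exp 1 ^ d := by
      rw [← Real.exp_nat_mul]; ring_nf
    rw [this]
    gcongr
    exact Real.exp_one_lt_three.le
  have hs : √(2 * d : ℝ) ≤ 2 * d := by
    rw [Real.sqrt_le_left (by positivity)]
    nlinarith
  calc (rawNormSq d)⁻¹
      ≤ (d * (2 * stdGauss √(2 * d) * (1 / (20 * √(2 * d) ^ 5))))⁻¹ :=
        inv_anti₀ (by positivity) (le_rawNormSq hd)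
    _ = 10 * √(2 * d) ^ 5 * (stdGauss √(2 * d))⁻¹ / d := by
        field_simp; norm_num
    _ ≤ 10 * (2 * d) ^ 5 * (3 * 3 ^ d) / d := by gcongr
    _ = 960 * d ^ 4 * 3 ^ d := by field_simp; norm_num
    _ ≤ 961 * d ^ 4 * 961 ^ d := by gcongr <;> norm_num
    _ = 961 * 961 ^ d * (d : ℝ) ^ 4 := by ring
    _ ≤ 961 * 961 ^ d * (d : ℝ) ^ (2 * (d + 1)) := by gcongr; omega
    _ = ((31 * d) ^ (d + 1)) ^ 2 := by
        rw [show (961 : ℝ) ^ d = 31 ^ (2 * d) by rw [pow_mul]; norm_num]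
        ring

/-- The piecewise linear approximation of `rawTarget d`. -/
noncomputable def plTarget (d N : ℕ) (s : ℝ) (x : Fin d → ℝ) : ℝ :=
  ∑ j, plSquare N s (max (|x j| - √(2 * d)) 0)

lemma integral_plTarget_sub_sq_le (hd : 1 ≤ d) {n : ℕ} (hn : 1 ≤ n) :
    ∫ x : Fin d → ℝ, (plTarget d (n ^ 2 * d) (1 / (n * d)) x - rawTarget d x) ^ 2 *
      gaussDensity d x ≤ 15040 / (n : ℝ) ^ 2 * rawNormSq d := by
  have hd' : (1 : ℝ) ≤ d := by exact_mod_cast hd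
  have hn' : (1 : ℝ) ≤ n := by exact_mod_cast hn
  set N := n ^ 2 * d with hN
  set s : ℝ := 1 / (n * d) with hs
  have hN0 : 0 < N := by positivity
  have hs0 : 0 < s := by positivity
  have hNs : N * s = n := by
    rw [hN, hs]; push_cast; field_simp
  have ha0 : 0 < √(2 * d : ℝ) := by positivity
  have ha2 : √(2 * d : ℝ) ^ 2 = 2 * d := Real.sq_sqrt (by positivity)
  set a := √(2 * d : ℝ) with ha
  have hφ := stdGauss_pos a
  set G : ℝ → ℝ := fun y => (plSquare N s y - y ^ 2) ^ 2 with hG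
  have hGc : Continuous G := by
    have := continuous_plSquare N s
    fun_prop
  have hGb : ∀ y, 0 ≤ y → G y ≤ 8 * s ^ 2 * y ^ 2 + 2 / (n : ℝ) ^ 2 * y ^ 6 := fun y hy => by
    rw [← hNs]; exact plSquare_sub_sq_sq_le hN0 hs0 hy
  have hi1 : Integrable fun t => G (max (|t| - a) 0) * stdGauss t := by
    refine integrable_mul_stdGauss (A := 8 * s ^ 2 * 4 + 2 / (n : ℝ) ^ 2 * 384)
      (Continuous.measurable (by fun_prop)) fun t => ?_
    rw [abs_of_nonneg (sq_nonneg _)]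
    refine (hGb _ (le_max_right _ _)).trans ?_
    have h2 := excess_pow_le ha0.le t 1
    have h6 := excess_pow_le ha0.le t 3
    norm_num [Nat.factorial] at h2 h6
    calc 8 * s ^ 2 * (max (|t| - a) 0) ^ 2 + 2 / (n : ℝ) ^ 2 * (max (|t| - a) 0) ^ 6
        ≤ 8 * s ^ 2 * (4 * Real.exp (t ^ 2 / 4)) +
          2 / (n : ℝ) ^ 2 * (384 * Real.exp (t ^ 2 / 4)) := by gcongr
      _ = _ := by ring
  have hi := fun j : Fin d => integrable_coord hi1 j
  have h1 : ∫ t, G (max (|t| - a) 0) * stdGauss t ≤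
      2 * stdGauss a * (752 / (n ^ 2 * d * a ^ 5)) := by
    rw [integral_excess ha0.le G (by simp [hG, plSquare_zero N hs0.le])]
    gcongr
    refine (integral_pow_excess_le ha0 hGc (fun y => sq_nonneg _) hGb).trans (le_of_eq ?_)
    norm_num [Nat.factorial]
    have e3 : a ^ 5 = a ^ 3 * (2 * d) := by rw [← ha2]; ring
    have e7 : a ^ 7 = a ^ 3 * (2 * d) ^ 2 := by rw [← ha2]; ring
    rw [e3, e7, hs]
    field_simp
    ring
  calc ∫ x : Fin d → ℝ, (plTarget d N s x - rawTarget d x) ^ 2 * gaussDensity d x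
      ≤ ∫ x : Fin d → ℝ, d * ∑ j, G (max (|x j| - a) 0) * gaussDensity d x := by
        refine integral_mono_of_nonneg (Filter.Eventually.of_forall fun x =>
          mul_nonneg (sq_nonneg _) (gaussDensity_pos x).le)
          ((integrable_finsetSum _ fun j _ => hi j).const_mul _)
          (Filter.Eventually.of_forall fun x => ?_)
        simp only
        rw [← Finset.sum_mul, ← mul_assoc]
        refine mul_le_mul_of_nonneg_right ?_ (gaussDensity_pos x).le
        unfold plTarget rawTarget
        rw [← Finset.sum_sub_distrib]
        refine (sq_sum_le_card_mul_sum_sq (s := Finset.univ)).trans ?_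
        rw [Finset.card_univ, Fintype.card_fin]
    _ = d * (d * ∫ t, G (max (|t| - a) 0) * stdGauss t) := by
        rw [integral_const_mul, integral_finsetSum _ fun j _ => hi j]
        simp only [integral_coord (fun t => G (max (|t| - a) 0))]
        rw [Finset.sum_const, Finset.card_univ, Fintype.card_fin, nsmul_eq_mul]
    _ ≤ d * (d * (2 * stdGauss a * (752 / (n ^ 2 * d * a ^ 5)))) := by gcongr
    _ = 15040 / (n : ℝ) ^ 2 * (d * (2 * stdGauss a * (1 / (20 * a ^ 5)))) := by
        field_simp; norm_num
    _ ≤ _ := by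
        gcongr
        exact le_rawNormSq hd

/-- A network computing the normalised piecewise linear approximation has a small error. -/
lemma l2Error_le_of_realize_eq (hd : 1 ≤ d) {n : ℕ} (hn : 1 ≤ n) {ε : ℝ} (hε : 0 < ε)
    (hnε : 130 / ε ≤ n) (Φ : ANN d 1)
    (hΦ : ∀ x, Φ.realize x 0 =
      (rawNormSq d) ^ (-(1 / 2) : ℝ) * plTarget d (n ^ 2 * d) (1 / (n * d)) x) :
    l2Error Φ ≤ ε := by
  have hI := rawNormSq_pos hd
  unfold l2Error
  have h1 : ∫ x : Fin d → ℝ, |Φ.realize x 0 - target d x| ^ 2 * gaussDensity d x ≤ ε ^ 2 := by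
    have h2 : ∀ x, |Φ.realize x 0 - target d x| ^ 2 * gaussDensity d x = (rawNormSq d)⁻¹ *
        ((plTarget d (n ^ 2 * d) (1 / (n * d)) x - rawTarget d x) ^ 2 * gaussDensity d x) := by
      intro x
      rw [sq_abs, hΦ, target_eq, ← mul_sub, mul_pow, rawNormSq_rpow_sq hd, mul_assoc]
    simp only [h2]
    rw [integral_const_mul]
    have hn' : (1 : ℝ) ≤ n := by exact_mod_cast hn
    calc _ ≤ (rawNormSq d)⁻¹ * (15040 / (n : ℝ) ^ 2 * rawNormSq d) := by
          gcongr
          exact integral_plTarget_sub_sq_le hd hn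
      _ = 15040 / (n : ℝ) ^ 2 := by field_simp
      _ ≤ ε ^ 2 := by
          rw [div_le_iff₀ hε] at hnε
          rw [div_le_iff₀ (by positivity), ← mul_pow]
          nlinarith
  calc _ ≤ (ε ^ 2) ^ (1 / 2 : ℝ) := by
        refine Real.rpow_le_rpow (integral_nonneg fun x => ?_) h1 (by norm_num)
        exact mul_nonneg (sq_nonneg _) (gaussDensity_pos x).le
    _ = ε := by rw [← Real.sqrt_eq_rpow, Real.sqrt_sq hε.le]

end Target

lemma norm_append_le_iff {m n : ℕ} {u : Fin m → ℝ} {v : Fin n → ℝ} {T : ℝ} (hT : 0 ≤ T) :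
    ‖Fin.append u v‖ ≤ T ↔ ‖u‖ ≤ T ∧ ‖v‖ ≤ T := by
  simp only [pi_norm_le_iff_of_nonneg hT]
  constructor
  · intro h
    exact ⟨fun i => by simpa using h (Fin.castAdd n i), fun i => by simpa using h (Fin.natAdd m i)⟩
  · rintro ⟨h1, h2⟩ i
    refine Fin.addCases (fun i => ?_) (fun i => ?_) i
    · simpa using h1 i
    · simpa using h2 i

namespace ANN

lemma norm_layerVec_le_iff {m n : ℕ} {W : Matrix (Fin n) (Fin m) ℝ} {B : Fin n → ℝ} {T : ℝ}
    (hT : 0 ≤ T) : ‖layerVec W B‖ ≤ T ↔ (∀ i j, |W i j| ≤ T) ∧ ∀ i, |B i| ≤ T := by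
  refine (norm_append_le_iff (n := n) hT).trans (and_congr ?_ ?_)
  · rw [pi_norm_le_iff_of_nonneg hT]
    constructor
    · intro h i j
      simpa using h (finProdFinEquiv (i, j))
    · intro h i
      exact h _ _
  · rw [pi_norm_le_iff_of_nonneg hT]
    rfl

lemma norm_paramVec_output_le_iff {m n : ℕ} {W : Matrix (Fin n) (Fin m) ℝ} {B : Fin n → ℝ}
    {T : ℝ} (hT : 0 ≤ T) :
    ‖(output W B).paramVec‖ ≤ T ↔ (∀ i j, |W i j| ≤ T) ∧ ∀ i, |B i| ≤ T :=
  norm_layerVec_le_iff hT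

lemma norm_paramVec_hidden_le_iff {m k n : ℕ} {hk : 0 < k} {W : Matrix (Fin k) (Fin m) ℝ}
    {B : Fin k → ℝ} {Ψ : ANN k n} {T : ℝ} (hT : 0 ≤ T) :
    ‖(hidden hk W B Ψ).paramVec‖ ≤ T ↔
      ((∀ i j, |W i j| ≤ T) ∧ ∀ i, |B i| ≤ T) ∧ ‖Ψ.paramVec‖ ≤ T :=
  (norm_append_le_iff (n := Ψ.numParams) hT).trans
    (and_congr_left' (norm_layerVec_le_iff hT))

lemma norm_affine_le {m n : ℕ} {W : Matrix (Fin n) (Fin m) ℝ} {B : Fin n → ℝ} {T : ℝ}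
    (hT : 0 ≤ T) (hW : ∀ i j, |W i j| ≤ T) (hB : ∀ i, |B i| ≤ T) (x : Fin m → ℝ) :
    ‖W.mulVec x + B‖ ≤ T * (m + 1) * max 1 ‖x‖ := by
  rw [pi_norm_le_iff_of_nonneg (by positivity)]
  intro i
  have h1 : |∑ j, W i j * x j| ≤ ∑ j : Fin m, T * max 1 ‖x‖ := by
    refine (Finset.abs_sum_le_sum_abs _ _).trans (Finset.sum_le_sum fun j _ => ?_)
    rw [abs_mul]
    exact mul_le_mul (hW i j) ((norm_le_pi_norm x j).trans (le_max_right _ _)) (abs_nonneg _) hT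
  rw [Finset.sum_const, Finset.card_univ, Fintype.card_fin, nsmul_eq_mul] at h1
  have h2 : T ≤ T * max 1 ‖x‖ := le_mul_of_one_le_right hT (le_max_left _ _)
  calc ‖(W.mulVec x + B) i‖ ≤ |∑ j, W i j * x j| + |B i| := abs_add_le _ _
    _ ≤ m * (T * max 1 ‖x‖) + T * max 1 ‖x‖ := add_le_add h1 ((hB i).trans h2)
    _ = _ := by ring

lemma norm_relu_le {d : ℕ} (x : Fin d → ℝ) : ‖relu x‖ ≤ ‖x‖ := by
  rw [pi_norm_le_iff_of_nonneg (norm_nonneg _)]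
  intro i
  refine le_trans ?_ (norm_le_pi_norm x i)
  simp only [relu, Real.norm_eq_abs]
  rw [abs_of_nonneg (le_max_right _ _)]
  exact max_le (le_abs_self _) (abs_nonneg _)

lemma continuous_realize {m n : ℕ} (Φ : ANN m n) : Continuous Φ.realize := by
  induction Φ with
  | output W B =>
    exact (Continuous.matrix_mulVec continuous_const continuous_id).add continuous_const
  | hidden hk W B Ψ ih =>
    refine ih.comp ?_
    have h : Continuous fun x => W.mulVec x + B :=
      (Continuous.matrix_mulVec continuous_const continuous_id).add continuous_const
    exact continuous_pi fun i => ((continuous_apply i).comp h).max continuous_const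

lemma succ_le_numParams {m n : ℕ} (Φ : ANN m n) (hn : 0 < n) : m + 1 ≤ Φ.numParams := by
  cases Φ with
  | output W B => exact Nat.le_mul_of_pos_left _ hn
  | hidden hk W B Ψ => exact (Nat.le_mul_of_pos_left _ hk).trans (Nat.le_add_right _ _)

/-- The growth of a realization in terms of the size and number of the parameters. -/
lemma norm_realize_le {m n : ℕ} (Φ : ANN m n) (hn : 0 < n) {T P : ℝ} (hT : 1 ≤ T)
    (hΦT : ‖Φ.paramVec‖ ≤ T) (hΦP : (Φ.numParams : ℝ) ≤ P) (x : Fin m → ℝ) :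
    ‖Φ.realize x‖ ≤ (T * P) ^ (Φ.numHidden + 1) * max 1 ‖x‖ := by
  have hT0 : 0 ≤ T := zero_le_one.trans hT
  induction Φ with
  | @output m n W B =>
    obtain ⟨hW, hB⟩ := (norm_paramVec_output_le_iff hT0).1 hΦT
    have hP : (m + 1 : ℝ) ≤ P := by
      refine le_trans ?_ hΦP
      exact_mod_cast succ_le_numParams (output W B) hn
    refine (norm_affine_le hT0 hW hB x).trans ?_
    simp only [numHidden, zero_add, pow_one]
    gcongr
  | @hidden m k n hk W B Ψ ih =>
    obtain ⟨⟨hW, hB⟩, hΨ⟩ := (norm_paramVec_hidden_le_iff hT0).1 hΦT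
    have hP : (m + 1 : ℝ) ≤ P := by
      refine le_trans ?_ hΦP
      exact_mod_cast succ_le_numParams (hidden hk W B Ψ) hn
    have hP1 : 1 ≤ P := by linarith [(Nat.cast_nonneg m : (0 : ℝ) ≤ m)]
    have hΨP : (Ψ.numParams : ℝ) ≤ P := by
      refine le_trans ?_ hΦP
      exact_mod_cast Nat.le_add_left _ _
    refine (ih hn hΨ hΨP _).trans ?_
    have h1 : max 1 ‖relu (W.mulVec x + B)‖ ≤ T * P * max 1 ‖x‖ := by
      refine max_le ?_ ((norm_relu_le _).trans ((norm_affine_le hT0 hW hB x).trans ?_))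
      · exact one_le_mul_of_one_le_of_one_le (one_le_mul_of_one_le_of_one_le hT hP1)
          (le_max_left _ _)
      · gcongr
    calc (T * P) ^ (Ψ.numHidden + 1) * max 1 ‖relu (W.mulVec x + B)‖
        ≤ (T * P) ^ (Ψ.numHidden + 1) * (T * P * max 1 ‖x‖) := by gcongr
      _ = _ := by simp only [numHidden]; ring

/-- Multiplication of a nonnegative scalar by `κ ^ (k + 1)` with `k` hidden layers. -/
noncomputable def mulChain (κ : ℝ) : ℕ → ANN 1 1
  | 0 => output (fun _ _ => κ) 0
  | k + 1 => hidden one_pos (fun _ _ => κ) 0 (mulChain κ k)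

lemma numHidden_mulChain (κ : ℝ) (k : ℕ) : (mulChain κ k).numHidden = k := by
  induction k with
  | zero => rfl
  | succ k ih => simp [mulChain, numHidden, ih]

lemma numParams_mulChain (κ : ℝ) (k : ℕ) : (mulChain κ k).numParams = 2 * (k + 1) := by
  induction k with
  | zero => rfl
  | succ k ih => simp only [mulChain, numParams, ih]; ring

lemma norm_paramVec_mulChain_le {κ T : ℝ} (hT : |κ| ≤ T) (k : ℕ) :
    ‖(mulChain κ k).paramVec‖ ≤ T := by
  have hT0 : 0 ≤ T := (abs_nonneg _).trans hT
  induction k with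
  | zero => exact (norm_paramVec_output_le_iff hT0).2 ⟨fun _ _ => hT, by simpa using hT0⟩
  | succ k ih =>
    exact (norm_paramVec_hidden_le_iff hT0).2 ⟨⟨fun _ _ => hT, by simpa using hT0⟩, ih⟩

lemma realize_mulChain {κ : ℝ} (hκ : 0 ≤ κ) (k : ℕ) {x : Fin 1 → ℝ} (hx : 0 ≤ x 0) :
    (mulChain κ k).realize x 0 = κ ^ (k + 1) * x 0 := by
  induction k generalizing x with
  | zero => simp [mulChain, realize, Matrix.mulVec, dotProduct]
  | succ k ih =>
    have h : relu (Matrix.mulVec (fun _ _ => κ : Matrix (Fin 1) (Fin 1) ℝ) x + 0) 0 = κ * x 0 := by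
      simp [relu, Matrix.mulVec, dotProduct, mul_nonneg hκ hx]
    simp only [mulChain, realize]
    rw [ih (by rw [h]; exact mul_nonneg hκ hx), h]
    ring

/-- A wide hidden layer with affine part `(W, B)`, a summation with common weight `β`, and a
multiplication by `κ ^ (k + 1)`. -/
noncomputable def sumNet {d K : ℕ} (hK : 0 < K) (W : Matrix (Fin K) (Fin d) ℝ) (B : Fin K → ℝ)
    (β κ : ℝ) (k : ℕ) : ANN d 1 :=
  hidden hK W B (hidden one_pos (fun _ _ => β) 0 (mulChain κ k))

section SumNet

variable {d K : ℕ} (hK : 0 < K) (W : Matrix (Fin K) (Fin d) ℝ) (B : Fin K → ℝ) (β κ : ℝ) (k : ℕ)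

lemma numHidden_sumNet : (sumNet hK W B β κ k).numHidden = k + 2 := by
  simp [sumNet, numHidden, numHidden_mulChain]

lemma numParams_sumNet :
    (sumNet hK W B β κ k).numParams = K * (d + 1) + (K + 1 + 2 * (k + 1)) := by
  simp [sumNet, numParams, numParams_mulChain]

variable {W B β κ}

lemma norm_paramVec_sumNet_le {T : ℝ} (hW : ∀ i j, |W i j| ≤ T) (hB : ∀ i, |B i| ≤ T)
    (hβ : |β| ≤ T) (hκ : |κ| ≤ T) : ‖(sumNet hK W B β κ k).paramVec‖ ≤ T := by
  have hT : 0 ≤ T := (abs_nonneg _).trans hκ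
  exact (norm_paramVec_hidden_le_iff hT).2 ⟨⟨hW, hB⟩, (norm_paramVec_hidden_le_iff hT).2
    ⟨⟨fun _ _ => hβ, by simpa using hT⟩, norm_paramVec_mulChain_le hκ k⟩⟩

lemma realize_sumNet (hβ : 0 ≤ β) (hκ : 0 ≤ κ) (x : Fin d → ℝ) :
    (sumNet hK W B β κ k).realize x 0 =
      κ ^ (k + 1) * (β * ∑ i, max (∑ j, W i j * x j + B i) 0) := by
  have h : relu (Matrix.mulVec (fun _ _ => β : Matrix (Fin 1) (Fin K) ℝ)
      (relu (W.mulVec x + B)) + 0) 0 = β * ∑ i, max (∑ j, W i j * x j + B i) 0 := by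
    simp only [relu, Matrix.mulVec, dotProduct, Pi.add_apply, Pi.zero_apply, add_zero,
      ← Finset.mul_sum]
    exact max_eq_left (mul_nonneg hβ (Finset.sum_nonneg fun i _ => le_max_right _ _))
  simp only [sumNet, realize]
  rw [realize_mulChain hκ, h]
  rw [h]
  exact mul_nonneg hβ (Finset.sum_nonneg fun i _ => le_max_right _ _)

end SumNet

end ANN

lemma max_excess_sub {a c : ℝ} (h : 0 ≤ c) (hac : 0 < a + c) (t : ℝ) :
    max (max (|t| - a) 0 - c) 0 = max (t - (a + c)) 0 + max (-t - (a + c)) 0 := by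
  rcases le_total 0 t with ht | ht
  · rw [abs_of_nonneg ht, max_eq_right (a := -t - (a + c)) (by linarith), add_zero]
    rcases le_total (t - a) 0 with h1 | h1
    · rw [max_eq_right h1, max_eq_right (by linarith), max_eq_right (by linarith)]
    · rw [max_eq_left h1, sub_sub]
  · rw [abs_of_nonpos ht, max_eq_right (a := t - (a + c)) (by linarith), zero_add]
    rcases le_total (-t - a) 0 with h1 | h1
    · rw [max_eq_right h1, max_eq_right (by linarith), max_eq_right (by linarith)]
    · rw [max_eq_left h1, sub_sub]

/-- Networks whose realizations are multiples of `plTarget`, with every neuron of the first hidden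
layer repeated `m` times. -/
lemma exists_net_plTarget {d n m : ℕ} (hd : 1 ≤ d) (hn : 1 ≤ n) (hm : 1 ≤ m) {β κ : ℝ}
    (hβ : 0 ≤ β) (hκ : 0 ≤ κ) (k : ℕ) :
    ∃ Φ : ANN d 1, Φ.numHidden = k + 2 ∧
      Φ.numParams = m * (d * (2 * (n ^ 2 * d))) * (d + 1) +
        (m * (d * (2 * (n ^ 2 * d))) + 1 + 2 * (k + 1)) ∧
      (∀ T : ℝ, 1 ≤ T → √(2 * d) + n ≤ T → β ≤ T → κ ≤ T → ‖Φ.paramVec‖ ≤ T) ∧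
      ∀ x, Φ.realize x 0 = κ ^ (k + 1) * (β * m * (n * d / 2)) *
        plTarget d (n ^ 2 * d) (1 / (n * d)) x := by
  have hd' : (1 : ℝ) ≤ d := by exact_mod_cast hd
  have hn' : (1 : ℝ) ≤ n := by exact_mod_cast hn
  set N := n ^ 2 * d with hN
  set s : ℝ := 1 / (n * d) with hs
  have hs0 : 0 < s := by positivity
  have hNs : N * s = n := by
    rw [hN, hs]; push_cast; field_simp
  have ha : 0 < √(2 * d : ℝ) := by positivity
  set K := m * (d * (2 * N)) with hKdef
  have hK : 0 < K := by positivity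
  let e : (Fin m × Fin d × Bool × Fin N) ≃ Fin K :=
    Fintype.equivFinOfCardEq (by simp [hKdef])
  let W : Matrix (Fin K) (Fin d) ℝ := fun i j =>
    if (e.symm i).2.1 = j then (if (e.symm i).2.2.1 then 1 else -1) else 0
  let B : Fin K → ℝ := fun i => -(√(2 * d) + ((e.symm i).2.2.2 : ℕ) * s)
  refine ⟨ANN.sumNet hK W B β κ k, ANN.numHidden_sumNet .., ANN.numParams_sumNet .., ?_, ?_⟩
  · intro T hT hTB hTβ hTκ
    refine ANN.norm_paramVec_sumNet_le hK k ?_ ?_ (by rwa [abs_of_nonneg hβ])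
      (by rwa [abs_of_nonneg hκ])
    · intro i j
      simp only [W]
      split_ifs <;> simp <;> linarith
    · intro i
      simp only [B]
      rw [abs_neg, abs_of_nonneg (by positivity)]
      have : (((e.symm i).2.2.2 : ℕ) : ℝ) ≤ N := by exact_mod_cast (e.symm i).2.2.2.is_lt.le
      have : (((e.symm i).2.2.2 : ℕ) : ℝ) * s ≤ N * s := by gcongr
      linarith
  · intro x
    rw [ANN.realize_sumNet hK k hβ hκ]
    have h1 : ∑ i, max (∑ j, W i j * x j + B i) 0 =
        ∑ q : Fin m × Fin d × Bool × Fin N,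
          max ((if q.2.2.1 then 1 else -1) * x q.2.1 - (√(2 * d) + (q.2.2.2 : ℕ) * s)) 0 := by
      rw [← e.sum_comp]
      refine Finset.sum_congr rfl fun q _ => ?_
      simp only [W, B, Equiv.symm_apply_apply, ite_mul, zero_mul, Finset.sum_ite_eq,
        Finset.mem_univ, if_true, sub_eq_add_neg]
    have h2 : plTarget d N s x = 2 * s * ∑ j, ∑ l : Fin N,
        (max (x j - (√(2 * d) + (l : ℕ) * s)) 0 + max (-x j - (√(2 * d) + (l : ℕ) * s)) 0) := by
      unfold plTarget plSquare
      rw [Finset.mul_sum]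
      refine Finset.sum_congr rfl fun j _ => ?_
      rw [Finset.mul_sum, Finset.sum_range]
      refine Finset.sum_congr rfl fun l _ => ?_
      rw [max_excess_sub (by positivity) (by positivity)]
    have h3 : ∑ i, max (∑ j, W i j * x j + B i) 0 = m * ∑ j, ∑ l : Fin N,
        (max (x j - (√(2 * d) + (l : ℕ) * s)) 0 + max (-x j - (√(2 * d) + (l : ℕ) * s)) 0) := by
      rw [h1]
      simp only [Fintype.sum_prod_type, Finset.sum_const, Finset.card_univ, Fintype.card_fin,
        nsmul_eq_mul, Fintype.sum_bool, if_true, Finset.sum_add_distrib, one_mul]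
      simp [mul_add]
    have h4 : (n * d / 2 : ℝ) * (2 * s) = 1 := by
      rw [hs]; field_simp
    rw [h3, h2]
    linear_combination (-κ ^ (k + 1) * β * m * ∑ j, ∑ l : Fin N,
      (max (x j - (√(2 * d) + (l : ℕ) * s)) 0 + max (-x j - (√(2 * d) + (l : ℕ) * s)) 0)) * h4

lemma sqrt_add_le {d n : ℕ} (hd : 1 ≤ d) : √(2 * d : ℝ) + n ≤ (2 + n) * d := by
  have hd' : (1 : ℝ) ≤ d := by exact_mod_cast hd
  have hs : √(2 * d : ℝ) ≤ 2 * d := by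
    rw [Real.sqrt_le_left (by positivity)]
    nlinarith
  nlinarith [(Nat.cast_nonneg n : (0 : ℝ) ≤ n)]

lemma mul_le_mul_rpow {C c x : ℝ} (hC : 1 ≤ C) (hc : C ≤ c) (hx : 1 ≤ x) :
    C * x ≤ c * x ^ c := by
  have h : x ≤ x ^ c := by
    simpa using Real.rpow_le_rpow_of_exponent_le hx (hC.trans hc)
  have : 0 ≤ c := by linarith
  gcongr

/-- Deep networks with cubically many parameters. -/
lemma exists_deep_net {ε : ℝ} (hε : 0 < ε) {n : ℕ} (hn : 1 ≤ n) (hnε : 130 / ε ≤ n) {c : ℝ}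
    (hc : 6 * (n : ℝ) ^ 2 + 31 ≤ c) {d : ℕ} (hd : 1 ≤ d) :
    ∃ Φ : ANN d 1, (d : ℝ) ≤ (Φ.numHidden : ℝ) ∧ (Φ.numHidden : ℝ) ≤ c * (d : ℝ) ∧
      ‖Φ.paramVec‖ ≤ c * (d : ℝ) ^ c ∧ l2Error Φ ≤ ε ∧ (Φ.numParams : ℝ) ≤ c * (d : ℝ) ^ 3 := by
  have hd' : (1 : ℝ) ≤ d := by exact_mod_cast hd
  have hn' : (1 : ℝ) ≤ n := by exact_mod_cast hn
  set I := (rawNormSq d) ^ (-(1 / 2) : ℝ) with hI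
  have hI0 : 0 ≤ I := Real.rpow_nonneg (rawNormSq_pos hd).le _
  set κ : ℝ := I ^ ((d + 1 : ℕ) : ℝ)⁻¹ with hκ
  have hκ0 : 0 ≤ κ := Real.rpow_nonneg hI0 _
  have hκI : κ ^ (d + 1) = I := Real.rpow_inv_natCast_pow hI0 (by omega)
  have hκd : κ ≤ 31 * d := by
    refine le_of_pow_le_pow_left₀ (n := d + 1) (by omega) (by positivity) ?_
    rw [hκI]
    exact rawNormSq_rpow_le hd
  have hcd := mul_le_mul_rpow (C := 6 * (n : ℝ) ^ 2 + 31) (by nlinarith) hc hd'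
  obtain ⟨Φ, hH, hP, hT, hR⟩ := exists_net_plTarget hd hn le_rfl (β := 2 / (n * d)) (κ := κ)
    (by positivity) hκ0 d
  have h3 : 0 ≤ (n : ℝ) ^ 2 * d := by positivity
  refine ⟨Φ, ?_, ?_, ?_, ?_, ?_⟩
  · rw [hH]; push_cast; linarith
  · rw [hH]; push_cast; nlinarith
  · refine hT _ ?_ ((sqrt_add_le hd).trans ?_) ?_ ?_
    · nlinarith
    · nlinarith
    · have : 2 / (n * d : ℝ) ≤ 2 := div_le_self (by norm_num) (by nlinarith)
      nlinarith
    · nlinarith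
  · refine l2Error_le_of_realize_eq hd hn hε hnε Φ fun x => ?_
    have h4 : 2 / (n * d : ℝ) * (1 : ℕ) * (n * d / 2) = 1 := by field_simp; simp
    rw [hR, hκI, h4, mul_one]
  · rw [hP]
    push_cast
    have hd3 : (d : ℝ) ^ 2 ≤ d ^ 3 := pow_le_pow_right₀ hd' (by norm_num)
    have hd2 : (d : ℝ) ≤ d ^ 3 := by simpa using pow_le_pow_right₀ hd' (show 1 ≤ 3 by norm_num)
    have hn2 : (n : ℝ) ^ 2 * d ^ 2 ≤ n ^ 2 * d ^ 3 := by gcongr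
    calc _ = 2 * ((n : ℝ) ^ 2 * d ^ 3) + 4 * (n ^ 2 * d ^ 2) + 2 * d + 3 := by ring
      _ ≤ (6 * (n : ℝ) ^ 2 + 31) * d ^ 3 := by nlinarith
      _ ≤ _ := by gcongr

/-- Networks with two hidden layers and bounded parameters. -/
lemma exists_shallow_net {ε : ℝ} (hε : 0 < ε) {n : ℕ} (hn : 1 ≤ n) (hnε : 130 / ε ≤ n) {c : ℝ}
    (hc : 2 + (n : ℝ) ≤ c) {d : ℕ} (hd : 1 ≤ d) :
    ∃ Φ : ANN d 1, Φ.numHidden = 2 ∧ ‖Φ.paramVec‖ ≤ c * (d : ℝ) ^ c ∧ l2Error Φ ≤ ε := by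
  have hd' : (1 : ℝ) ≤ d := by exact_mod_cast hd
  have hn' : (1 : ℝ) ≤ n := by exact_mod_cast hn
  set I := (rawNormSq d) ^ (-(1 / 2) : ℝ) with hI
  have hI0 : 0 ≤ I := Real.rpow_nonneg (rawNormSq_pos hd).le _
  obtain ⟨m, hm⟩ := exists_nat_ge (I * (2 / (n * d)) + 1)
  have hm0 : 0 ≤ I * (2 / (n * d)) := by positivity
  have hm1 : (1 : ℝ) ≤ m := by linarith
  have hcd := mul_le_mul_rpow (C := 2 + (n : ℝ)) (by linarith) hc hd'
  have hc1 : 1 ≤ c * (d : ℝ) ^ c := by nlinarith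
  obtain ⟨Φ, hH, -, hT, hR⟩ := exists_net_plTarget hd hn (m := m) (by exact_mod_cast hm1)
    (β := I * (2 / (n * d)) / m) (κ := 1) (by positivity) zero_le_one 0
  refine ⟨Φ, hH, hT _ hc1 ((sqrt_add_le hd).trans hcd) ?_ hc1, ?_⟩
  · refine le_trans ?_ hc1
    rw [div_le_one (by linarith)]
    linarith
  · refine l2Error_le_of_realize_eq hd hn hε hnε Φ fun x => ?_
    have h4 : I * (2 / (n * d : ℝ)) / m * m * (n * d / 2) = I := by field_simp
    rw [hR, h4, one_pow, one_mul]

lemma integral_exp_mul_stdGauss_le : ∫ t, Real.exp (t ^ 2 / 4) * stdGauss t ≤ 2 := by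
  have h : ∀ t : ℝ, Real.exp (t ^ 2 / 4) * stdGauss t =
      (√(2 * Real.pi))⁻¹ * Real.exp (-(1 / 4) * t ^ 2) := by
    intro t
    unfold stdGauss
    rw [mul_left_comm, ← Real.exp_add]
    ring_nf
  simp only [h]
  rw [integral_const_mul, integral_gaussian, inv_mul_le_iff₀ (by positivity)]
  calc √(Real.pi / (1 / 4)) ≤ √(2 ^ 2 * (2 * Real.pi)) := by
        apply Real.sqrt_le_sqrt
        linarith [Real.pi_pos]
    _ = √(2 * Real.pi) * 2 := by
        rw [Real.sqrt_mul (by norm_num), Real.sqrt_sq (by norm_num)]; ring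

section LowerBound

variable {d : ℕ}

lemma exists_max_norm_sq_le (hd : 1 ≤ d) (x : Fin d → ℝ) :
    ∃ i, ‖x‖ = |x i| ∧ (max 1 ‖x‖) ^ 2 ≤ 1 + x i ^ 2 := by
  have : Nonempty (Fin d) := ⟨⟨0, hd⟩⟩
  obtain ⟨i, hi⟩ := Finite.exists_max fun i => ‖x i‖
  have hx : ‖x‖ = |x i| :=
    le_antisymm ((pi_norm_le_iff_of_nonneg (norm_nonneg _)).2 hi) (norm_le_pi_norm x i)
  refine ⟨i, hx, ?_⟩
  rw [hx]
  rcases le_total 1 |x i| with h | h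
  · rw [max_eq_right h, sq_abs]; linarith
  · rw [max_eq_left h]; nlinarith [sq_nonneg (x i)]

lemma max_norm_sq_le (hd : 1 ≤ d) (x : Fin d → ℝ) :
    (max 1 ‖x‖) ^ 2 ≤ 4 * ∑ j, Real.exp (x j ^ 2 / 4) := by
  obtain ⟨i, -, hi⟩ := exists_max_norm_sq_le hd x
  have h1 := Real.add_one_le_exp (x i ^ 2 / 4)
  have h2 := Finset.single_le_sum (f := fun j => Real.exp (x j ^ 2 / 4))
    (fun j _ => (Real.exp_pos _).le) (Finset.mem_univ i)
  linarith

lemma max_norm_sq_le_of_rawTarget_ne_zero (hd : 1 ≤ d) {x : Fin d → ℝ} (hx : rawTarget d x ≠ 0) :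
    (max 1 ‖x‖) ^ 2 ≤ 8 * Real.exp (-(d / 4)) * ∑ j, Real.exp (x j ^ 2 / 4) := by
  obtain ⟨i, hxi, hi⟩ := exists_max_norm_sq_le hd x
  have h0 : √(2 * d : ℝ) < |x i| := by
    obtain ⟨j, -, hj⟩ := Finset.exists_ne_zero_of_sum_ne_zero hx
    have : √(2 * d : ℝ) < |x j| := by
      by_contra hc
      push Not at hc
      exact hj (by rw [max_eq_right (by linarith)]; norm_num)
    exact this.trans_le (hxi ▸ norm_le_pi_norm x j)
  have h3 : 2 * d < x i ^ 2 := by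
    rw [← sq_abs, ← Real.sqrt_lt' ((Real.sqrt_nonneg _).trans_lt h0)]
    exact h0
  have h1 := Real.add_one_le_exp (x i ^ 2 / 8)
  have h2 := Finset.single_le_sum (f := fun j => Real.exp (x j ^ 2 / 4))
    (fun j _ => (Real.exp_pos _).le) (Finset.mem_univ i)
  calc (max 1 ‖x‖) ^ 2 ≤ 8 * Real.exp (x i ^ 2 / 8) := by linarith
    _ ≤ 8 * (Real.exp (-(d / 4)) * Real.exp (x i ^ 2 / 4)) := by
        rw [← Real.exp_add]
        gcongr
        linarith
    _ = 8 * Real.exp (-(d / 4)) * Real.exp (x i ^ 2 / 4) := by ring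
    _ ≤ _ := by gcongr

lemma measurable_target (d : ℕ) : Measurable (target d) := by
  have h : target d = fun x => (rawNormSq d) ^ (-(1 / 2) : ℝ) * rawTarget d x :=
    funext target_eq
  rw [h]
  exact (measurable_rawTarget d).const_mul _

lemma target_sq_eq (hd : 1 ≤ d) (x : Fin d → ℝ) :
    target d x ^ 2 = (rawNormSq d)⁻¹ * rawTarget d x ^ 2 := by
  rw [target_eq, mul_pow, rawNormSq_rpow_sq hd]

lemma integral_target_sq (hd : 1 ≤ d) :
    ∫ x : Fin d → ℝ, target d x ^ 2 * gaussDensity d x = 1 := by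
  simp only [target_sq_eq hd, mul_assoc]
  rw [integral_const_mul]
  exact inv_mul_cancel₀ (rawNormSq_pos hd).ne'

/-- A network of linear growth with constant `M` can only be close to the target if `M` is
exponentially large. -/
lemma exp_le_of_l2Error_le (hd : 1 ≤ d) {Φ : ANN d 1} {M : ℝ}
    (hM : ∀ x, ‖Φ.realize x‖ ≤ M * max 1 ‖x‖) (hΦ : l2Error Φ ≤ 1 / 2) :
    Real.exp (d / 4) ≤ 64 * d * M ^ 2 := by
  have hR : ∀ x, Φ.realize x 0 ^ 2 ≤ M ^ 2 * (max 1 ‖x‖) ^ 2 := by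
    intro x
    rw [← mul_pow, ← sq_abs]
    exact pow_le_pow_left₀ (abs_nonneg _) ((norm_le_pi_norm _ 0).trans (hM x)) 2
  have hR' : ∀ x, (Φ.realize x 0 - target d x) ^ 2 ≤
      2 * Φ.realize x 0 ^ 2 + 2 * target d x ^ 2 := fun x => by
    nlinarith [sq_nonneg (Φ.realize x 0 + target d x)]
  have hmeas : Measurable fun x => Φ.realize x 0 :=
    ((continuous_apply 0).comp Φ.continuous_realize).measurable
  have hI := rawNormSq_pos hd
  have hdiff : Integrable fun x => (Φ.realize x 0 - target d x) ^ 2 * gaussDensity d x := by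
    refine integrable_mul_gaussDensity ((hmeas.sub (measurable_target d)).pow_const 2)
      (A := 2 * M ^ 2 * 4 + 2 * (rawNormSq d)⁻¹ * (32 * d)) fun x => ?_
    rw [abs_of_nonneg (sq_nonneg _)]
    calc (Φ.realize x 0 - target d x) ^ 2
        ≤ 2 * (M ^ 2 * (max 1 ‖x‖) ^ 2) + 2 * ((rawNormSq d)⁻¹ * rawTarget d x ^ 2) := by
          rw [← target_sq_eq hd]; linarith [hR x, hR' x]
      _ ≤ 2 * (M ^ 2 * (4 * ∑ j, Real.exp (x j ^ 2 / 4))) +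
          2 * ((rawNormSq d)⁻¹ * (32 * d * ∑ j, Real.exp (x j ^ 2 / 4))) := by
          gcongr
          · exact max_norm_sq_le hd x
          · exact rawTarget_sq_le x
      _ = _ := by ring
  have hJ : ∫ x, (Φ.realize x 0 - target d x) ^ 2 * gaussDensity d x ≤ 1 / 4 := by
    unfold l2Error at hΦ
    simp only [sq_abs] at hΦ
    rw [← Real.sqrt_eq_rpow, Real.sqrt_le_left (by norm_num)] at hΦ
    norm_num at hΦ ⊢
    exact hΦ
  set A := 2 * M ^ 2 * (8 * Real.exp (-(d / 4))) with hA
  have hA0 : 0 ≤ A := by positivity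
  have hpt : ∀ x, target d x ^ 2 ≤
      A * (∑ j, Real.exp (x j ^ 2 / 4)) + 2 * (Φ.realize x 0 - target d x) ^ 2 := by
    intro x
    have hS : 0 ≤ ∑ j, Real.exp (x j ^ 2 / 4) :=
      Finset.sum_nonneg fun j _ => (Real.exp_pos _).le
    by_cases hx : rawTarget d x = 0
    · have ht : target d x = 0 := by rw [target_eq, hx, mul_zero]
      rw [ht, zero_pow two_ne_zero]
      positivity
    · have h1 : Φ.realize x 0 ^ 2 ≤
          M ^ 2 * (8 * Real.exp (-(d / 4)) * ∑ j, Real.exp (x j ^ 2 / 4)) :=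
        (hR x).trans (mul_le_mul_of_nonneg_left (max_norm_sq_le_of_rawTarget_ne_zero hd hx)
          (sq_nonneg M))
      have h2 : target d x ^ 2 ≤
          2 * Φ.realize x 0 ^ 2 + 2 * (Φ.realize x 0 - target d x) ^ 2 := by
        nlinarith [sq_nonneg (2 * Φ.realize x 0 - target d x)]
      rw [hA]
      nlinarith
  have hE : ∀ j : Fin d, Integrable fun x : Fin d → ℝ =>
      Real.exp (x j ^ 2 / 4) * gaussDensity d x := fun j =>
    integrable_coord (F := fun t => Real.exp (t ^ 2 / 4)) integrable_exp_mul_stdGauss j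
  have hmain : 1 ≤ A * (d * 2) + 2 * (1 / 4) := by
    calc 1 = ∫ x : Fin d → ℝ, target d x ^ 2 * gaussDensity d x := (integral_target_sq hd).symm
      _ ≤ ∫ x : Fin d → ℝ, (A * (∑ j, Real.exp (x j ^ 2 / 4) * gaussDensity d x) +
          2 * ((Φ.realize x 0 - target d x) ^ 2 * gaussDensity d x)) := by
          refine integral_mono_of_nonneg (Filter.Eventually.of_forall fun x =>
            mul_nonneg (sq_nonneg _) (gaussDensity_pos x).le)
            (((integrable_finsetSum _ fun j _ => hE j).const_mul A).add (hdiff.const_mul 2))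
            (Filter.Eventually.of_forall fun x => ?_)
          simp only
          rw [← Finset.sum_mul, ← mul_assoc, ← mul_assoc, ← add_mul]
          exact mul_le_mul_of_nonneg_right (hpt x) (gaussDensity_pos x).le
      _ = A * (d * ∫ t, Real.exp (t ^ 2 / 4) * stdGauss t) +
          2 * ∫ x, (Φ.realize x 0 - target d x) ^ 2 * gaussDensity d x := by
          rw [integral_add ((integrable_finsetSum _ fun j _ => hE j).const_mul A)
            (hdiff.const_mul 2), integral_const_mul, integral_const_mul,
            integral_finsetSum _ fun j _ => hE j]
          simp only [integral_coord (fun t => Real.exp (t ^ 2 / 4))]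
          rw [Finset.sum_const, Finset.card_univ, Fintype.card_fin, nsmul_eq_mul]
      _ ≤ _ := by
          gcongr
          exact integral_exp_mul_stdGauss_le
  have hexp : Real.exp (d / 4) * Real.exp (-(d / 4)) = 1 := by
    rw [← Real.exp_add, add_neg_cancel, Real.exp_zero]
  have hpos := Real.exp_pos (d / 4 : ℝ)
  calc Real.exp (d / 4) ≤ Real.exp (d / 4) * (2 * (A * (d * 2))) :=
        le_mul_of_one_le_right hpos.le (by linarith)
    _ = 64 * d * M ^ 2 * (Real.exp (d / 4) * Real.exp (-(d / 4))) := by rw [hA]; ring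
    _ = 64 * d * M ^ 2 := by rw [hexp, mul_one]

/-- Networks of sublinear depth with polynomially bounded parameters need exponentially many
parameters. -/
lemma rpow_le_numParams {δ : ℝ} (hδ : δ ≤ 1) {c : ℝ} (hc : 64 ≤ c) (hd : 1 ≤ d) {Φ : ANN d 1}
    (hH : (Φ.numHidden : ℝ) ≤ c * (d : ℝ) ^ (1 - δ)) (hT : ‖Φ.paramVec‖ ≤ c * (d : ℝ) ^ c)
    (hΦ : l2Error Φ ≤ 1 / 2) :
    (1 + c ^ (-3 : ℝ)) ^ ((d : ℝ) ^ δ) ≤ (Φ.numParams : ℝ) := by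
  have hd' : (1 : ℝ) ≤ d := by exact_mod_cast hd
  have hd0 : (0 : ℝ) < d := by linarith
  have hc0 : 0 < c := by linarith
  set p : ℝ := (Φ.numParams : ℝ) with hp
  have hpd : (d : ℝ) + 1 ≤ p := by
    rw [hp]; exact_mod_cast Φ.succ_le_numParams one_pos
  have hp0 : 0 < p := by linarith
  set T := c * (d : ℝ) ^ c with hTdef
  have hdc : 1 ≤ (d : ℝ) ^ c := Real.one_le_rpow hd' hc0.le
  have hcT : c ≤ T := le_mul_of_one_le_right hc0.le hdc
  have hT0 : 0 < T := by linarith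
  have hM := exp_le_of_l2Error_le hd
    (Φ.norm_realize_le one_pos (T := T) (P := p) (by linarith) hT le_rfl) hΦ
  have hexp : Real.exp (d / 4) ≤ (T * p) ^ (2 * Φ.numHidden + 3) := by
    calc Real.exp (d / 4) ≤ 64 * d * ((T * p) ^ (Φ.numHidden + 1)) ^ 2 := hM
      _ ≤ (T * p) * ((T * p) ^ (Φ.numHidden + 1)) ^ 2 := by
          have : 64 * d ≤ T * p := mul_le_mul (by linarith) (by linarith) hd0.le hT0.le
          gcongr
      _ = _ := by ring
  have hlog : (d / 4 : ℝ) ≤ (2 * Φ.numHidden + 3) * Real.log (T * p) := by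
    have := Real.log_le_log (Real.exp_pos _) hexp
    rw [Real.log_exp, Real.log_pow] at this
    exact_mod_cast this
  have hL : 1 / 2 ≤ Real.log p := by
    have := Real.log_le_log (by norm_num) (show (2 : ℝ) ≤ p by linarith)
    linarith [Real.log_two_gt_d9]
  have hTp : Real.log (T * p) ≤ 4 * c * Real.log p := by
    rw [Real.log_mul hT0.ne' hp0.ne', hTdef, Real.log_mul hc0.ne' (by positivity),
      Real.log_rpow hd0]
    have h1 := Real.log_le_sub_one_of_pos hc0
    have h2 : c * Real.log d ≤ c * Real.log p := by
      gcongr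
      linarith
    nlinarith
  have hdδ : 1 ≤ (d : ℝ) ^ (1 - δ) := Real.one_le_rpow hd' (by linarith)
  have hH3 : (2 * Φ.numHidden + 3 : ℝ) ≤ 3 * c * (d : ℝ) ^ (1 - δ) := by nlinarith
  have hfin : (d : ℝ) ^ δ ≤ 48 * c ^ 2 * Real.log p := by
    have h1 : (d / 4 : ℝ) ≤ 3 * c * (d : ℝ) ^ (1 - δ) * (4 * c * Real.log p) :=
      hlog.trans (mul_le_mul hH3 hTp (Real.log_nonneg (by nlinarith)) (by positivity))
    have h2 : (d : ℝ) = (d : ℝ) ^ δ * (d : ℝ) ^ (1 - δ) := by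
      rw [← Real.rpow_add hd0]; simp
    refine le_of_mul_le_mul_right ?_ (show 0 < (d : ℝ) ^ (1 - δ) by linarith)
    rw [← h2]
    linarith
  have hc3 : c ^ (-3 : ℝ) = (c ^ 3)⁻¹ := by
    rw [Real.rpow_neg hc0.le]
    norm_cast
  calc (1 + c ^ (-3 : ℝ)) ^ ((d : ℝ) ^ δ) ≤ (Real.exp (c ^ (-3 : ℝ))) ^ ((d : ℝ) ^ δ) := by
        have := Real.add_one_le_exp (c ^ (-3 : ℝ))
        gcongr
        linarith
    _ = Real.exp (c ^ (-3 : ℝ) * (d : ℝ) ^ δ) := by rw [Real.exp_mul]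
    _ ≤ Real.exp (Real.log p) := by
        apply Real.exp_le_exp.2
        rw [hc3, inv_mul_le_iff₀ (by positivity)]
        refine hfin.trans ?_
        gcongr
        nlinarith [sq_nonneg c]
    _ = p := Real.exp_log hp0

end LowerBound

lemma exists_isLeast_and {S : Set ℕ} {Q : ℕ → Prop} (h : S.Nonempty)
    (hQ : ∀ p, IsLeast S p → Q p) : ∃ p, IsLeast S p ∧ Q p :=
  ⟨sInf S, ⟨Nat.sInf_mem h, fun _ hx => Nat.sInf_le hx⟩,
    hQ _ ⟨Nat.sInf_mem h, fun _ hx => Nat.sInf_le hx⟩⟩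

theorem theorem6p1 (δ ε : ℝ) (hδ : δ ∈ Set.Ioc (0 : ℝ) 1) (hε : ε ∈ Set.Ioc (0 : ℝ) (1 / 2)) :
    ∃ C : ℝ, 0 < C ∧
      (∀ c : ℝ, C ≤ c → ∀ d : ℕ, 1 ≤ d →
        ∃ p : ℕ,
          IsLeast {p : ℕ | ∃ Φ : ANN d 1, p = Φ.numParams ∧
            (d : ℝ) ≤ (Φ.numHidden : ℝ) ∧ (Φ.numHidden : ℝ) ≤ c * (d : ℝ) ∧
            ‖Φ.paramVec‖ ≤ c * (d : ℝ) ^ c ∧ l2Error Φ ≤ ε} p ∧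
          (p : ℝ) ≤ c * (d : ℝ) ^ 3) ∧
      (∀ c : ℝ, C ≤ c → ∀ d : ℕ, 1 ≤ d →
        ∃ p : ℕ,
          IsLeast {p : ℕ | ∃ Φ : ANN d 1, p = Φ.numParams ∧
            (Φ.numHidden : ℝ) ≤ c * (d : ℝ) ^ (1 - δ) ∧
            ‖Φ.paramVec‖ ≤ c * (d : ℝ) ^ c ∧ l2Error Φ ≤ ε} p ∧
          (1 + c ^ (-3 : ℝ)) ^ ((d : ℝ) ^ δ) ≤ (p : ℝ)) := by
  obtain ⟨hδ0, hδ1⟩ := hδ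
  obtain ⟨hε0, hε1⟩ := hε
  obtain ⟨n, hnε⟩ := exists_nat_ge (130 / ε)
  have hn0 : (0 : ℝ) < n := (by positivity : 0 < 130 / ε).trans_le hnε
  have hn : 1 ≤ n := by exact_mod_cast hn0
  have hn' : (1 : ℝ) ≤ n := by exact_mod_cast hn
  refine ⟨6 * (n : ℝ) ^ 2 + 64, by positivity, fun c hc d hd => ?_, fun c hc d hd => ?_⟩
  · obtain ⟨Φ, h1, h2, h3, h4, h5⟩ := exists_deep_net hε0 hn hnε (c := c) (by linarith) hd
    refine exists_isLeast_and ⟨_, Φ, rfl, h1, h2, h3, h4⟩ fun p hp => le_trans ?_ h5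
    exact_mod_cast hp.2 ⟨Φ, rfl, h1, h2, h3, h4⟩
  · have hc2 : 2 ≤ c := by nlinarith
    obtain ⟨Φ, h1, h2, h3⟩ := exists_shallow_net hε0 hn hnε (c := c) (by nlinarith) hd
    have hH : (Φ.numHidden : ℝ) ≤ c * (d : ℝ) ^ (1 - δ) := by
      have : 1 ≤ (d : ℝ) ^ (1 - δ) := Real.one_le_rpow (by exact_mod_cast hd) (by linarith)
      rw [h1]
      push_cast
      nlinarith
    refine exists_isLeast_and ⟨_, Φ, rfl, hH, h2, h3⟩ fun p hp => ?_
    obtain ⟨Ψ, rfl, hΨ1, hΨ2, hΨ3⟩ := hp.1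
    exact rpow_le_numParams hδ1 (by nlinarith) hd hΨ1 hΨ2 (hΨ3.trans hε1)
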